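/- Theorem 3 (parallel). There is an absolute constant $C>0$ such that the following holds. Let $\mathcal P$ be a finite set of mutually independent random variables in a probability space, and let $\mathcal A$ be a finite family of events determined by these variables. For $A\in\mathcal A$ let $\mathrm{vbl}(A)\subseteq\mathcal P$ be the least set of variables that determines $A$. The dependency graph $G$ on $\mathcal A$ joins $A\ne B$ whenever $\mathrm{vbl}(A)\cap \mathrm{vbl}(B)\neq\emptyset$; let $\Gamma(A)$ be the neighborhood of $A$ in $G$. Suppose that $\varepsilon>0$ and $x:\mathcal A\to(0,1)$ satisfy $$\forall A\in\mathcal A:\quad \Pr[A]\le(1-\varepsilon)\,x(A)\prod_{B\in\Gamma(A)}(1-x(B)).$$ Consider the parallel algorithm: start with an independent random evaluation of each variable in $\mathcal P$; while some event of $\mathcal A$ is violated by (that is, happens under) the current evaluation, select, by an arbitrary deterministic or randomized procedure, a maximal independent set $S$ in the subgraph of $G$ induced by the violated events, and replace the values of all the variables in $\bigcup_{A\in S}\mathrm{vbl}(A)$ by new independent random samples, keeping all other values; each variable has an infinite list of independent samples with its distribution (the lists of different variables being independent), and each new evaluation of the variable takes the next unused entry of its list. Then the expected number of steps (executions of the while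 loop) before an evaluation violating no event in $\mathcal A$ is found is at most $$\frac{C}{\varepsilon}\,\log\Bigl(1+\sum_{A\in\mathcal A}\frac{x(A)}{1-x(A)}\Bigr).$$ In particular the algorithm terminates with probability 1. -/

import Mathlib

open MeasureTheory ProbabilityTheory
open scoped ENNReal

namespace ParallelLLL

/-! An evaluation of the variables is a point `v : ∀ i, α i`; an event determined by the
variables is given by the set `E` of the evaluations that violate it (that make it happen). -/

/-- `vbl E`: the least set of variables that determines the event `E`
(see `isLeast_vbl`: for finitely many variables the least determining set exists). -/
def vbl {ι : Type*} {α : ι → Type*} (E : Set (∀ i, α i)) : Set ι :=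
  ⋂₀ {T : Set ι | DependsOn (fun v : ∀ i, α i => v ∈ E) T}

theorem dependsOn_inter {ι : Type*} {α : ι → Type*} {E : Set (∀ i, α i)} {s t : Set ι}
    (hs : DependsOn (fun v : ∀ i, α i => v ∈ E) s)
    (ht : DependsOn (fun v : ∀ i, α i => v ∈ E) t) :
    DependsOn (fun v : ∀ i, α i => v ∈ E) (s ∩ t) := by
  classical
  intro x y hxy
  let z : ∀ i, α i := fun i => if i ∈ s then x i else y i
  have h1 : (x ∈ E) = (z ∈ E) := hs (x := x) (y := z) (fun i hi => by simp [z, hi])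
  have h2 : (z ∈ E) = (y ∈ E) := ht (x := z) (y := y) (fun i hi => by
    by_cases his : i ∈ s
    · simpa [z, his] using hxy i ⟨his, hi⟩
    · simp [z, his])
  exact h1.trans h2

/-- Among the sets of variables that determine `E` there is a least one, namely `vbl E`. -/
theorem isLeast_vbl {ι : Type*} [Finite ι] {α : ι → Type*} (E : Set (∀ i, α i)) :
    IsLeast {T : Set ι | DependsOn (fun v : ∀ i, α i => v ∈ E) T} (vbl E) := by
  refine ⟨?_, fun T hT => Set.sInter_subset_of_mem hT⟩
  have hne : {T : Set ι | DependsOn (fun v : ∀ i, α i => v ∈ E) T}.Nonempty := by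
    refine ⟨Set.univ, fun x y h => ?_⟩
    have hxy : x = y := funext fun i => h i (Set.mem_univ i)
    rw [hxy]
  obtain ⟨T, hT⟩ := (Set.toFinite {T : Set ι |
    DependsOn (fun v : ∀ i, α i => v ∈ E) T}).exists_minimal hne
  have hTv : vbl E = T := by
    refine Set.Subset.antisymm (Set.sInter_subset_of_mem hT.prop) ?_
    refine Set.subset_sInter fun T' hT' => ?_
    have := hT.le_of_le (dependsOn_inter hT.prop hT') Set.inter_subset_left
    exact fun i hi => (this hi).2
  rw [hTv]
  exact hT.prop

/-- The dependency graph of a family of events: two different events are adjacent if they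
depend on a common variable. -/
def depGraph {ι κ : Type*} {α : ι → Type*} (E : κ → Set (∀ i, α i)) : SimpleGraph κ where
  Adj a b := a ≠ b ∧ (vbl (E a) ∩ vbl (E b)).Nonempty
  symm := ⟨fun _ _ h => ⟨h.1.symm, by rw [Set.inter_comm]; exact h.2⟩⟩
  loopless := ⟨fun _ h => h.1 rfl⟩

open Classical in
/-- The neighborhood `Γ(a)` of an event in the dependency graph. -/
noncomputable def nbhd {ι κ : Type*} [Fintype κ] {α : ι → Type*} (E : κ → Set (∀ i, α i))
    (a : κ) : Finset κ :=
  Finset.univ.filter fun b => (depGraph E).Adj a b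

/-- The events violated by the evaluation `v`. -/
def violated {ι κ : Type*} {α : ι → Type*} (E : κ → Set (∀ i, α i)) (v : ∀ i, α i) : Set κ :=
  {a | v ∈ E a}

/-- `S` is an inclusion-maximal independent set in the subgraph of the dependency graph
spanned by the events violated by `v`. -/
def IsMaxIndepViolated {ι κ : Type*} {α : ι → Type*} (E : κ → Set (∀ i, α i))
    (v : ∀ i, α i) (S : Set κ) : Prop :=
  Maximal (fun T : Set κ => T ⊆ violated E v ∧ (depGraph E).IsIndepSet T) S

open Classical in
/-- `resampleCount E S n i`: how often the variable `i` has been resampled in the first `n`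
rounds, if round `m` resamples all the variables on which the events in `S m` depend. -/
noncomputable def resampleCount {ι κ : Type*} {α : ι → Type*} (E : κ → Set (∀ i, α i))
    (S : ℕ → Set κ) : ℕ → ι → ℕ
  | 0, _ => 0
  | n + 1, i =>
      if i ∈ ⋃ a ∈ S n, vbl (E a) then resampleCount E S n i + 1 else resampleCount E S n i

/-- The evaluation held by the algorithm after `n` rounds. The random source supplies for every
variable `i` a list `X i 0, X i 1, …` of samples. The initial value of `i` is `X i 0`, and
whenever a new sample of `i` is called for, the next unused entry of its list is taken. -/
noncomputable def evalAfter {ι κ : Type*} {α : ι → Type*} (E : κ → Set (∀ i, α i))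
    (X : ∀ i, ℕ → α i) (S : ℕ → Set κ) (n : ℕ) : ∀ i, α i :=
  fun i => X i (resampleCount E S n i)

/-- `S n` is a legitimate selection in round `n`, for every `n`, on the samples `X`.
(When no event is violated, this says `S n = ∅`, so that the evaluation no longer changes.) -/
def IsRun {ι κ : Type*} {α : ι → Type*} (E : κ → Set (∀ i, α i))
    (X : ∀ i, ℕ → α i) (S : ℕ → Set κ) : Prop :=
  ∀ n, IsMaxIndepViolated E (evalAfter E X S n) (S n)

/-- The number of rounds made before an evaluation violating no event is found
(`⊤` if the algorithm does not terminate). -/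
noncomputable def rounds {ι κ : Type*} {α : ι → Type*} (E : κ → Set (∀ i, α i))
    (X : ∀ i, ℕ → α i) (S : ℕ → Set κ) : ℕ∞ :=
  ⨅ (n : ℕ) (_ : violated E (evalAfter E X S n) = ∅), (n : ℕ∞)

end ParallelLLL

/-! The proof bounds the probability that round `n` resamples anything, by a union bound over
witnesses. Suppose `a` is resampled in round `N`. Follow chains of related resamplings (equal or
adjacent events) backwards in time, and sort what is reached by the length of the longest chain
leading to it. Every event of round `k + 1` has a related one in round `k`, by maximality of the
selection, so the depths `0, …, N` all occur. Each layer is independent and lies in the closed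
neighborhood of the layer above it. The layers alone determine which table entry each resampling
reads: the index for variable `i` is the number of deeper layers touching `i` (`IsDepth.card_eq`).
So a fixed list of layers must pass a test on the samples in which no entry is read twice. It passes
with probability `∏ Pr[b]` (`measureReal_passing`), however the selection was made. With `y = x / (1
- x)` the hypothesis says that `Pr[b]` times the product of `1 + y` over the closed neighborhood is
at most `(1 - ε) * y b`. Summing over layers from the deepest upwards gains a factor `1 - ε` per
layer (`sum_witnesses_le`), so `Pr[a ∈ S n] ≤ (1 - ε) ^ (n + 1) * y a`. With `w = ∑ y`, the expected
number of rounds is at most `∑ min 1 ((1 - ε) ^ (n + 1) * w)`, which telescopes against logarithms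
(`tsum_min_one_le`). -/

namespace ParallelLLL

/-! ### Chains of resamplings and their layers by depth. -/

section Combinatorics

variable {ι κ : Type*} {α : ι → Type*}

/-- Two events are related if they are equal or adjacent in the dependency graph. -/
def Related (E : κ → Set (∀ i, α i)) (a b : κ) : Prop :=
  a = b ∨ (depGraph E).Adj a b

theorem Related.symm {E : κ → Set (∀ i, α i)} {a b : κ} (h : Related E a b) : Related E b a :=
  h.imp Eq.symm SimpleGraph.Adj.symm

theorem related_of_mem_vbl {E : κ → Set (∀ i, α i)} {a b : κ} {i : ι}
    (ha : i ∈ vbl (E a)) (hb : i ∈ vbl (E b)) : Related E a b := by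
  by_cases h : a = b
  · exact Or.inl h
  · exact Or.inr ⟨h, i, ha, hb⟩

theorem Related.eq_of_mem_isIndepSet {E : κ → Set (∀ i, α i)} {a b : κ} {T : Set κ}
    (h : Related E a b) (hT : (depGraph E).IsIndepSet T) (ha : a ∈ T) (hb : b ∈ T) : a = b := by
  by_contra hab
  exact hT ha hb hab (h.resolve_left hab)

theorem mem_iff_of_eqOn_vbl [Finite ι] {A : Set (∀ i, α i)} {v w : ∀ i, α i}
    (h : ∀ i ∈ vbl A, v i = w i) : v ∈ A ↔ w ∈ A :=
  iff_of_eq ((isLeast_vbl A).1 h)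

open Classical in
theorem resampleCount_eq_card (E : κ → Set (∀ i, α i)) (S : ℕ → Set κ) (n : ℕ) (i : ι) :
    resampleCount E S n i =
      ((Finset.range n).filter fun k => ∃ a ∈ S k, i ∈ vbl (E a)).card := by
  induction n with
  | zero => simp [resampleCount]
  | succ n ih =>
    rw [resampleCount, Finset.range_add_one, Finset.filter_insert, ih]
    simp only [Set.mem_iUnion, exists_prop]
    split_ifs
    · rw [Finset.card_insert_of_notMem (by simp)]
    · rfl

/-- Otherwise `a` could be added to `S`, against maximality. -/
theorem IsMaxIndepViolated.exists_related {E : κ → Set (∀ i, α i)} {v : ∀ i, α i} {S : Set κ}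
    (h : IsMaxIndepViolated E v S) {a : κ} (ha : v ∈ E a) : ∃ b ∈ S, Related E a b := by
  by_contra! hcon
  have hins : insert a S ⊆ violated E v ∧ (depGraph E).IsIndepSet (insert a S) := by
    refine ⟨Set.insert_subset ha h.prop.1, ?_⟩
    refine Set.Pairwise.insert h.prop.2 fun b hb _ => ⟨fun hab => ?_, fun hba => ?_⟩
    · exact hcon b hb (Or.inr hab)
    · exact hcon b hb (Or.inr hba.symm)
  have := h.le_of_ge hins (Set.subset_insert a S) (Set.mem_insert a S)
  exact hcon a this (Or.inl rfl)

/-- Either `a` was already violated in round `n`, and maximality applies, or it became violated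
because round `n` changed one of its variables. -/
theorem IsRun.exists_related_succ [Finite ι] {E : κ → Set (∀ i, α i)} {X : ∀ i, ℕ → α i}
    {S : ℕ → Set κ} (h : IsRun E X S) {n : ℕ} {a : κ} (ha : a ∈ S (n + 1)) :
    ∃ b ∈ S n, Related E a b := by
  by_cases hv : evalAfter E X S n ∈ E a
  · exact (h n).exists_related hv
  · by_contra! hcon
    refine hv ((mem_iff_of_eqOn_vbl fun i hi => ?_).1 ((h (n + 1)).prop.1 ha))
    have : ¬ i ∈ ⋃ b ∈ S n, vbl (E b) := by
      simp only [Set.mem_iUnion, exists_prop, not_exists, not_and]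
      exact fun b hb hib => hcon b hb (related_of_mem_vbl hi hib)
    simp only [evalAfter, resampleCount, if_neg this]

/-- `ResampleChain E S N a k b d`: there is a chain of `d` further resamplings leading from the
resampling of `b` in round `k` to that of `a` in round `N`, in which consecutive events are
related. -/
inductive ResampleChain (E : κ → Set (∀ i, α i)) (S : ℕ → Set κ) (N : ℕ) (a : κ) :
    ℕ → κ → ℕ → Prop
  | root : ResampleChain E S N a N a 0
  | step {k b d k' b'} : ResampleChain E S N a k b d → k' < k → b' ∈ S k' → Related E b b' →
      ResampleChain E S N a k' b' (d + 1)

/-- `d` is the length of a longest chain from the resampling of `b` in round `k`. -/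
def IsDepth (E : κ → Set (∀ i, α i)) (S : ℕ → Set κ) (N : ℕ) (a : κ) (k : ℕ) (b : κ) (d : ℕ) :
    Prop :=
  ResampleChain E S N a k b d ∧ ∀ d', ResampleChain E S N a k b d' → d' ≤ d

/-- The events that are resampled at depth `d`. -/
def layer (E : κ → Set (∀ i, α i)) (S : ℕ → Set κ) (N : ℕ) (a : κ) (d : ℕ) : Set κ :=
  {b | ∃ k, IsDepth E S N a k b d}

variable {E : κ → Set (∀ i, α i)} {S : ℕ → Set κ} {N : ℕ} {a : κ}

theorem ResampleChain.add_le {k b d} (h : ResampleChain E S N a k b d) : d + k ≤ N := by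
  induction h with
  | root => simp
  | step _ _ _ _ ih => omega

theorem ResampleChain.mem (ha : a ∈ S N) {k b d} (h : ResampleChain E S N a k b d) :
    b ∈ S k := by
  cases h with
  | root => exact ha
  | step _ _ h _ => exact h

theorem ResampleChain.exists_isDepth {k b d} (h : ResampleChain E S N a k b d) :
    ∃ d', IsDepth E S N a k b d' ∧ d ≤ d' := by
  classical
  refine ⟨Nat.findGreatest (ResampleChain E S N a k b) N, ⟨?_, fun d' h' => ?_⟩, ?_⟩
  · exact Nat.findGreatest_spec (by have := h.add_le; omega) h
  · exact Nat.le_findGreatest (by have := h'.add_le; omega) h'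
  · exact Nat.le_findGreatest (by have := h.add_le; omega) h

/-- A longest chain to the later resampling extends by one step. Hence, among related resamplings,
depth order reverses time order. -/
theorem IsDepth.lt_of_lt (ha : a ∈ S N) {k b d k' b' d'} (h : IsDepth E S N a k b d)
    (h' : IsDepth E S N a k' b' d') (hk : k' < k) (hR : Related E b b') : d < d' :=
  h'.2 _ (h.1.step hk (h'.1.mem ha) hR)

theorem IsDepth.round_eq (ha : a ∈ S N) {k b d k' b'} (h : IsDepth E S N a k b d)
    (h' : IsDepth E S N a k' b' d) (hR : Related E b b') : k = k' := by
  rcases lt_trichotomy k k' with hk | hk | hk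
  · exact absurd (h'.lt_of_lt ha h hk hR.symm) (lt_irrefl _)
  · exact hk
  · exact absurd (h.lt_of_lt ha h' hk hR) (lt_irrefl _)

theorem IsDepth.depth_eq (hS : ∀ k, (depGraph E).IsIndepSet (S k)) (ha : a ∈ S N) {k b d b' d'}
    (h : IsDepth E S N a k b d) (h' : IsDepth E S N a k b' d') (hR : Related E b b') : d = d' := by
  obtain rfl := hR.eq_of_mem_isIndepSet (hS k) (h.1.mem ha) (h'.1.mem ha)
  exact le_antisymm (h'.2 _ h.1) (h.2 _ h'.1)

theorem layer_zero : layer E S N a 0 = {a} := by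
  ext b
  constructor
  · rintro ⟨k, h, -⟩
    cases h
    rfl
  · rintro rfl
    exact ⟨N, .root, fun d' h => by have := h.add_le; omega⟩

/-- Removing the last step of a longest chain leaves a longest chain to its predecessor. -/
theorem exists_related_of_mem_layer_succ {d : ℕ} {b : κ} (hb : b ∈ layer E S N a (d + 1)) :
    ∃ c ∈ layer E S N a d, Related E c b := by
  obtain ⟨k, h, hmax⟩ := hb
  cases h with
  | @step k' c _ _ _ hc hk hm hR =>
    refine ⟨c, ⟨k', hc, fun d' h' => ?_⟩, hR⟩
    have := hmax _ (h'.step hk hm hR)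
    omega

theorem isIndepSet_layer (hS : ∀ k, (depGraph E).IsIndepSet (S k)) (ha : a ∈ S N) (d : ℕ) :
    (depGraph E).IsIndepSet (layer E S N a d) := by
  rintro b ⟨k, hb⟩ c ⟨k', hc⟩ hbc hadj
  obtain rfl := hb.round_eq ha hc (Or.inr hadj)
  exact hS k (hb.1.mem ha) (hc.1.mem ha) hbc hadj

theorem nonempty_layer (hS : ∀ k, ∀ b ∈ S (k + 1), ∃ c ∈ S k, Related E b c) (ha : a ∈ S N)
    {d : ℕ} (hd : d ≤ N) : (layer E S N a d).Nonempty := by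
  -- Going back one round at a time wastes no round, so the chain attains the bound `d + k ≤ N` and
  -- is longest.
  have key : ∀ d ≤ N, ∃ b, ResampleChain E S N a (N - d) b d := by
    intro d
    induction d with
    | zero => exact fun _ => ⟨a, .root⟩
    | succ d ih =>
      intro hd
      obtain ⟨b, hb⟩ := ih (by omega)
      have hb' : b ∈ S (N - (d + 1) + 1) := by
        have := hb.mem ha
        rwa [show N - (d + 1) + 1 = N - d by omega]
      obtain ⟨c, hc, hR⟩ := hS _ b hb'
      exact ⟨c, hb.step (by omega) hc hR⟩
  obtain ⟨b, hb⟩ := key d hd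
  exact ⟨b, _, hb, fun d' h' => by have := h'.add_le; omega⟩

open Classical in
/-- The resamplings of a variable of `b` before round `k` are those at a greater depth. -/
theorem IsDepth.card_eq (hS : ∀ k, (depGraph E).IsIndepSet (S k)) (ha : a ∈ S N) {k b d}
    (h : IsDepth E S N a k b d) {i : ι} (hi : i ∈ vbl (E b)) :
    ((Finset.range k).filter fun k => ∃ c ∈ S k, i ∈ vbl (E c)).card =
      ((Finset.Ico (d + 1) (N + 1)).filter
        fun d => ∃ c ∈ layer E S N a d, i ∈ vbl (E c)).card := by
  -- All events containing `i` are pairwise related, so `r` matches rounds and depths one to one: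
  -- `round_eq` and `depth_eq` give uniqueness in the two directions.
  let r : ℕ → ℕ → Prop := fun k' d' => ∃ c, IsDepth E S N a k' c d' ∧ i ∈ vbl (E c)
  apply le_antisymm
  · refine Finset.card_le_card_of_forall_subsingleton r (fun k' hk' => ?_) ?_
    · simp only [Finset.mem_filter, Finset.mem_range] at hk'
      obtain ⟨hlt, c, hc, hic⟩ := hk'
      obtain ⟨d', hd', hle⟩ := (h.1.step hlt hc (related_of_mem_vbl hi hic)).exists_isDepth
      refine ⟨d', ?_, c, hd', hic⟩
      have := hd'.1.add_le
      simp only [Finset.mem_filter, Finset.mem_Ico]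
      exact ⟨by omega, c, ⟨k', hd'⟩, hic⟩
    · rintro d' - k₁ ⟨-, c₁, h₁, hi₁⟩ k₂ ⟨-, c₂, h₂, hi₂⟩
      exact h₁.round_eq ha h₂ (related_of_mem_vbl hi₁ hi₂)
  · refine Finset.card_le_card_of_forall_subsingleton (fun d' k' => r k' d')
      (fun d' hd' => ?_) ?_
    · simp only [Finset.mem_filter, Finset.mem_Ico] at hd'
      obtain ⟨hd', c, ⟨k', hc⟩, hic⟩ := hd'
      have hR := related_of_mem_vbl hi hic
      refine ⟨k', ?_, c, hc, hic⟩
      simp only [Finset.mem_filter, Finset.mem_range]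
      refine ⟨?_, c, hc.1.mem ha, hic⟩
      rcases lt_trichotomy k k' with hk | rfl | hk
      · have := hc.lt_of_lt ha h hk hR.symm
        omega
      · have := h.depth_eq hS ha hc hR
        omega
      · exact hk
    · rintro k' - d₁ ⟨-, c₁, h₁, hi₁⟩ d₂ ⟨-, c₂, h₂, hi₂⟩
      exact h₁.depth_eq hS ha h₂ (related_of_mem_vbl hi₁ hi₂)

end Combinatorics

/-! ### Lists of layers as witnesses. -/

section Witness

variable {ι κ : Type*} {α : ι → Type*}

open Classical in
/-- The number of the layers in the list `L` that resample the variable `i`. -/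
noncomputable def layerCount (E : κ → Set (∀ i, α i)) (L : List (Finset κ)) (i : ι) : ℕ :=
  L.countP fun K => ∃ b ∈ K, i ∈ vbl (E b)

/-- The samples `X` pass the test of the list `L` of layers, the last of which is evaluated first:
every event occurring in it is violated by the samples that are current at that point. -/
def Passes (E : κ → Set (∀ i, α i)) (X : ∀ i, ℕ → α i) : List (Finset κ) → Prop
  | [] => True
  | K :: L => (∀ b ∈ K, (fun i => X i (layerCount E L i)) ∈ E b) ∧ Passes E X L

open Classical in
/-- The closed neighborhood of an event in the dependency graph. -/
noncomputable def closedNbhd [Fintype κ] (E : κ → Set (∀ i, α i)) (a : κ) : Finset κ :=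
  Finset.univ.filter fun b => Related E a b

open Classical in
/-- The layers that may follow the layer `J`. -/
noncomputable def nextLayers [Fintype κ] (E : κ → Set (∀ i, α i)) (J : Finset κ) :
    Finset (Finset κ) :=
  (J.biUnion (closedNbhd E)).powerset.filter
    fun K => K.Nonempty ∧ (depGraph E).IsIndepSet (K : Set κ)

open Classical in
/-- The lists of `n` layers that may follow the layer `J`. -/
noncomputable def witnesses [Fintype κ] (E : κ → Set (∀ i, α i)) :
    ℕ → Finset κ → Finset (List (Finset κ))
  | 0, _ => {[]}
  | n + 1, J => (nextLayers E J).biUnion fun K => (witnesses E n K).image (K :: ·)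

/-- Whatever is resampled in round `N` has a witness with `N + 1` layers. -/
theorem IsRun.exists_witness [Finite ι] [Fintype κ] {E : κ → Set (∀ i, α i)}
    {X : ∀ i, ℕ → α i} {S : ℕ → Set κ} (h : IsRun E X S) {N : ℕ} {a : κ} (ha : a ∈ S N) :
    ∃ L ∈ witnesses E N {a}, Passes E X ({a} :: L) := by
  classical
  have hS : ∀ k, (depGraph E).IsIndepSet (S k) := fun k => (h k).prop.2
  have hS' : ∀ k, ∀ b ∈ S (k + 1), ∃ c ∈ S k, Related E b c := fun k b hb =>
    h.exists_related_succ hb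
  let D : ℕ → Finset κ := fun d => (layer E S N a d).toFinset
  have hmemD : ∀ d b, b ∈ D d ↔ b ∈ layer E S N a d := fun d b => Set.mem_toFinset
  have hD0 : D 0 = {a} := by
    ext b
    rw [hmemD, layer_zero]
    simp
  have hwit : ∀ m d, d + m ≤ N → (List.range' (d + 1) m).map D ∈ witnesses E m (D d) := by
    intro m
    induction m with
    | zero => simp [witnesses]
    | succ m ih =>
      intro d hd
      simp only [witnesses, List.range'_succ, List.map_cons, Finset.mem_biUnion, Finset.mem_image]
      refine ⟨D (d + 1), ?_, _, ih (d + 1) (by omega), rfl⟩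
      simp only [nextLayers, Finset.mem_filter, Finset.mem_powerset]
      refine ⟨fun b hb => ?_, ?_, ?_⟩
      · obtain ⟨c, hc, hR⟩ := exists_related_of_mem_layer_succ ((hmemD _ _).1 hb)
        simp only [Finset.mem_biUnion, closedNbhd, Finset.mem_filter, Finset.mem_univ, true_and]
        exact ⟨c, (hmemD _ _).2 hc, hR⟩
      · obtain ⟨b, hb⟩ := nonempty_layer hS' ha (d := d + 1) (by omega)
        exact ⟨b, (hmemD _ _).2 hb⟩
      · have : ((D (d + 1) : Finset κ) : Set κ) = layer E S N a (d + 1) := Set.coe_toFinset _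
        rw [this]
        exact isIndepSet_layer hS ha _
  have hcount : ∀ m d i, layerCount E ((List.range' d m).map D) i =
      ((Finset.Ico d (d + m)).filter fun d => ∃ c ∈ layer E S N a d, i ∈ vbl (E c)).card := by
    intro m
    induction m with
    | zero => simp [layerCount]
    | succ m ih =>
      intro d i
      have := ih (d + 1) i
      rw [show d + 1 + m = d + (m + 1) by omega] at this
      rw [← Finset.insert_Ico_add_one_left_eq_Ico (show d < d + (m + 1) by omega),
        Finset.filter_insert]
      simp only [layerCount, List.range'_succ, List.map_cons, List.countP_cons,
        decide_eq_true_eq] at this ⊢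
      rw [this]
      simp only [hmemD]
      split_ifs
      · rw [Finset.card_insert_of_notMem (by simp)]
      · rfl
  have hpass : ∀ m d, d + m = N + 1 → Passes E X ((List.range' d m).map D) := by
    intro m
    induction m with
    | zero => simp [Passes]
    | succ m ih =>
      intro d hd
      rw [List.range'_succ, List.map_cons]
      refine ⟨fun b hb => ?_, ih (d + 1) (by omega)⟩
      obtain ⟨k, hk⟩ := (hmemD _ _).1 hb
      -- `b` was violated when resampled in round `k`, and on its variables the test reads the same
      -- entries as that evaluation.
      refine (mem_iff_of_eqOn_vbl fun i hi => ?_).1 ((h k).prop.1 (hk.1.mem ha))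
      rw [evalAfter, resampleCount_eq_card, hcount, hk.card_eq hS ha hi,
        show d + 1 + m = N + 1 by omega]
      congr!
  refine ⟨(List.range' 1 N).map D, ?_, ?_⟩
  · have := hwit N 0 (by omega)
    rwa [hD0] at this
  · have := hpass (N + 1) 0 (by omega)
    rwa [List.range'_succ, List.map_cons, hD0] at this

end Witness

end ParallelLLL

namespace ParallelLLL

/-! ### Independence of events on disjoint coordinates. -/

section Independence

theorem measureReal_and_of_dependsOn {Ω J : Type*} {β : J → Type*} [∀ j, MeasurableSpace (β j)]
    [MeasurableSpace Ω] {ν : Measure Ω} [IsProbabilityMeasure ν] {Y : ∀ j, Ω → β j}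
    (hY : iIndepFun Y ν) (hm : ∀ j, Measurable (Y j)) {A B : Set (∀ j, β j)}
    (hA : MeasurableSet A) (hB : MeasurableSet B) {s t : Finset J} (hst : Disjoint s t)
    (hAs : DependsOn (fun v => v ∈ A) (s : Set J)) (hBt : DependsOn (fun v => v ∈ B) (t : Set J)) :
    ν.real {ω | (fun j => Y j ω) ∈ A ∧ (fun j => Y j ω) ∈ B} =
      ν.real {ω | (fun j => Y j ω) ∈ A} * ν.real {ω | (fun j => Y j ω) ∈ B} := by
  classical
  -- `ω₀` only supplies filler values for the coordinates outside the finite set; the events do not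
  -- see them.
  obtain ⟨ω₀⟩ : Nonempty Ω := ν.nonempty_of_neZero
  let extend : ∀ u : Finset J, (∀ j : u, β j) → ∀ j, β j := fun u f j =>
    if h : j ∈ u then f ⟨j, h⟩ else Y j ω₀
  have hext : ∀ u, Measurable (extend u) := fun u => measurable_pi_lambda _ fun j => by
    by_cases h : j ∈ u
    · simpa only [extend, h, dite_true] using measurable_pi_apply _
    · simp only [extend, h, dite_false, measurable_const]
  have key : ∀ (u : Finset J) (D : Set (∀ j, β j)), DependsOn (fun v => v ∈ D) (u : Set J) →
      {ω | (fun j => Y j ω) ∈ D} = (fun ω (j : u) => Y j ω) ⁻¹' (extend u ⁻¹' D) := by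
    intro u D hD
    ext ω
    refine iff_of_eq (hD fun j hj => ?_)
    have hj' : j ∈ u := hj
    simp [extend, hj']
  have hind := (hY.indepFun_finset s t hst hm).measure_inter_preimage_eq_mul _ _
    (hext s hA) (hext t hB)
  rw [← key s A hAs, ← key t B hBt] at hind
  simpa only [Measure.real, ENNReal.toReal_mul, Set.ofPred_and] using congrArg ENNReal.toReal hind

end Independence

/-! ### The probability of passing a test. -/

section Witness

variable {ι κ : Type*} {α : ι → Type*}

open Classical in
theorem layerCount_cons (E : κ → Set (∀ i, α i)) (K : Finset κ) (L : List (Finset κ)) (i : ι) :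
    layerCount E (K :: L) i = layerCount E L i + if ∃ b ∈ K, i ∈ vbl (E b) then 1 else 0 := by
  simp only [layerCount, List.countP_cons, decide_eq_true_eq]

/-- The tables of samples that pass the test of the list `L` of layers. -/
def passing (E : κ → Set (∀ i, α i)) (L : List (Finset κ)) : Set (∀ p : ι × ℕ, α p.1) :=
  {Z | Passes E (fun i j => Z (i, j)) L}

/-- The tables of samples for which the event `b` is violated by the entries after `L`. -/
def violating (E : κ → Set (∀ i, α i)) (L : List (Finset κ)) (b : κ) :
    Set (∀ p : ι × ℕ, α p.1) :=
  {Z | (fun i => Z (i, layerCount E L i)) ∈ E b}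

open Classical in
/-- The entries of the table that are used by the test of the list `L` of layers. -/
noncomputable def usedEntries [Fintype ι] (E : κ → Set (∀ i, α i)) (L : List (Finset κ)) :
    Finset (ι × ℕ) :=
  Finset.univ.biUnion fun i => (Finset.range (layerCount E L i)).image (i, ·)

theorem mem_usedEntries [Fintype ι] {E : κ → Set (∀ i, α i)} {L : List (Finset κ)}
    {p : ι × ℕ} : p ∈ usedEntries E L ↔ p.2 < layerCount E L p.1 := by
  classical
  obtain ⟨i, j⟩ := p
  simp [usedEntries]

open Classical in
/-- The entries of the table that are used by `b` after the test of `L`. -/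
noncomputable def currentEntries [Fintype ι] (E : κ → Set (∀ i, α i)) (L : List (Finset κ))
    (b : κ) : Finset (ι × ℕ) :=
  (Finset.univ.filter fun i => i ∈ vbl (E b)).image fun i => (i, layerCount E L i)

theorem mem_currentEntries [Fintype ι] {E : κ → Set (∀ i, α i)} {L : List (Finset κ)} {b : κ}
    {p : ι × ℕ} : p ∈ currentEntries E L b ↔ p.1 ∈ vbl (E b) ∧ p.2 = layerCount E L p.1 := by
  classical
  obtain ⟨i, j⟩ := p
  simp only [currentEntries, Finset.mem_image, Finset.mem_filter, Finset.mem_univ, true_and,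
    Prod.mk.injEq]
  constructor
  · rintro ⟨k, hk, rfl, rfl⟩
    exact ⟨hk, rfl⟩
  · rintro ⟨hi, rfl⟩
    exact ⟨i, hi, rfl, rfl⟩

theorem dependsOn_violating [Fintype ι] (E : κ → Set (∀ i, α i)) (L : List (Finset κ)) (b : κ) :
    DependsOn (fun Z => Z ∈ violating E L b) (currentEntries E L b : Set (ι × ℕ)) := by
  intro Z Z' h
  refine propext (mem_iff_of_eqOn_vbl (A := E b) (v := fun i => Z (i, layerCount E L i))
    (w := fun i => Z' (i, layerCount E L i)) fun i hi => ?_)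
  exact h (i, layerCount E L i) (mem_currentEntries.2 ⟨hi, rfl⟩)

/-- An event of the top layer `K` reads index `layerCount E L i`, and `K` raises the count at `i` by
exactly one, so this index is the last one used. -/
theorem dependsOn_passing [Fintype ι] (E : κ → Set (∀ i, α i)) (L : List (Finset κ)) :
    DependsOn (fun Z => Z ∈ passing E L) (usedEntries E L : Set (ι × ℕ)) := by
  classical
  induction L with
  | nil => intro Z Z' _; rfl
  | cons K L ih =>
    intro Z Z' h
    have h1 : ∀ b ∈ K, (Z ∈ violating E L b) = (Z' ∈ violating E L b) := by
      intro b hb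
      refine dependsOn_violating E L b fun p hp => h p ?_
      obtain ⟨hp1, hp2⟩ := mem_currentEntries.1 hp
      rw [Finset.mem_coe, mem_usedEntries, layerCount_cons, if_pos ⟨b, hb, hp1⟩]
      omega
    have h2 : (Z ∈ passing E L) = (Z' ∈ passing E L) := ih fun p hp => h p <| by
      rw [Finset.mem_coe, mem_usedEntries] at hp ⊢
      rw [layerCount_cons]
      omega
    refine propext (and_congr ?_ (iff_of_eq h2))
    exact forall₂_congr fun b hb => iff_of_eq (h1 b hb)

variable [∀ i, MeasurableSpace (α i)]

theorem measurableSet_violating {E : κ → Set (∀ i, α i)} (hE : ∀ a, MeasurableSet (E a))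
    (L : List (Finset κ)) (b : κ) : MeasurableSet (violating E L b) :=
  (measurable_pi_lambda (fun (Z : ∀ p : ι × ℕ, α p.1) i => Z (i, layerCount E L i))
    fun i => measurable_pi_apply (i, layerCount E L i)) (hE b)

theorem measurableSet_passing {E : κ → Set (∀ i, α i)} (hE : ∀ a, MeasurableSet (E a))
    (L : List (Finset κ)) : MeasurableSet (passing E L) := by
  induction L with
  | nil => exact MeasurableSet.univ
  | cons K L ih =>
    have : passing E (K :: L) = (⋂ b ∈ K, violating E L b) ∩ passing E L := by
      ext Z
      simp [passing, violating, Passes]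
    rw [this]
    exact (K.measurableSet_biInter fun b _ => measurableSet_violating hE L b).inter ih

variable [Fintype ι] {Ω Ω' : Type*} [MeasurableSpace Ω] [MeasurableSpace Ω'] {μ : Measure Ω}
  {ν : Measure Ω'}
  {P : ∀ i, Ω → α i} {X : ∀ i, ℕ → Ω' → α i} {E : κ → Set (∀ i, α i)}

/-- One entry per variable is an independent family, so both sides are the product of the same
marginals. -/
theorem map_current_eq (hP : ∀ i, Measurable (P i)) (hPi : iIndepFun P μ)
    (hX : ∀ i j, Measurable (X i j))
    (hXi : iIndepFun (fun p : ι × ℕ => X p.1 p.2) ν)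
    (hXP : ∀ i j, IdentDistrib (X i j) (P i) ν μ) (c : ι → ℕ) :
    ν.map (fun ω i => X i (c i) ω) = μ.map (fun ω i => P i ω) := by
  have hc : iIndepFun (fun i => X i (c i)) ν :=
    hXi.precomp (g := fun i => (i, c i)) fun i j h => congrArg Prod.fst h
  rw [hc.map_fun_eq_pi_map fun i => (hX i _).aemeasurable,
    hPi.map_fun_eq_pi_map fun i => (hP i).aemeasurable]
  exact congrArg _ (funext fun i => (hXP i (c i)).map_eq)

theorem measureReal_violating (hP : ∀ i, Measurable (P i)) (hPi : iIndepFun P μ)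
    (hE : ∀ a, MeasurableSet (E a)) (hX : ∀ i j, Measurable (X i j))
    (hXi : iIndepFun (fun p : ι × ℕ => X p.1 p.2) ν)
    (hXP : ∀ i j, IdentDistrib (X i j) (P i) ν μ) (L : List (Finset κ)) (b : κ) :
    ν.real {ω | (fun p : ι × ℕ => X p.1 p.2 ω) ∈ violating E L b} =
      μ.real {ω | (fun i => P i ω) ∈ E b} := by
  have h := congrArg (fun ρ => ρ.real (E b))
    (map_current_eq hP hPi hX hXi hXP fun i => layerCount E L i)
  rwa [map_measureReal_apply (measurable_pi_lambda _ fun i => hX i _) (hE b),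
    map_measureReal_apply (measurable_pi_lambda _ fun i => hP i) (hE b)] at h

/-- The samples pass the test of a list of independent sets of events with the probability
`∏ Pr[b]`, taken over all the occurrences of events in the list. -/
theorem measureReal_passing [IsProbabilityMeasure ν] (hP : ∀ i, Measurable (P i)) (hPi : iIndepFun P μ)
    (hE : ∀ a, MeasurableSet (E a)) (hX : ∀ i j, Measurable (X i j))
    (hXi : iIndepFun (fun p : ι × ℕ => X p.1 p.2) ν)
    (hXP : ∀ i j, IdentDistrib (X i j) (P i) ν μ) (L : List (Finset κ))
    (hL : ∀ K ∈ L, (depGraph E).IsIndepSet (K : Set κ)) :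
    ν.real {ω | (fun p : ι × ℕ => X p.1 p.2 ω) ∈ passing E L} =
      (L.map fun K => ∏ b ∈ K, μ.real {ω | (fun i => P i ω) ∈ E b}).prod := by
  classical
  induction L with
  | nil => simp [passing, Passes]
  | cons K L ih =>
    have hK := hL K (by simp)
    specialize ih fun K' hK' => hL K' (by simp [hK'])
    -- Events of the top layer are split off one at a time, each independent of the remaining ones
    -- and of the deeper layers.
    have key : ∀ K' ⊆ K,
        ν.real {ω | (fun p : ι × ℕ => X p.1 p.2 ω) ∈
          (⋂ b ∈ K', violating E L b) ∩ passing E L} =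
        (∏ b ∈ K', μ.real {ω | (fun i => P i ω) ∈ E b}) *
          (L.map fun K => ∏ b ∈ K, μ.real {ω | (fun i => P i ω) ∈ E b}).prod := by
      intro K'
      induction K' using Finset.induction_on with
      | empty => simp [ih]
      | insert b K' hb ih' =>
        intro hsub
        rw [Finset.insert_subset_iff] at hsub
        -- Events in one independent layer share no variable, and deeper layers use only indices
        -- strictly below the current one.
        have hdisj : Disjoint (currentEntries E L b)
            (K'.biUnion (currentEntries E L) ∪ usedEntries E L) := by
          rw [Finset.disjoint_left]
          intro p hp hp'
          rw [mem_currentEntries] at hp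
          rcases Finset.mem_union.1 hp' with h | h
          · obtain ⟨c, hc, hpc⟩ := Finset.mem_biUnion.1 h
            have hbc := (related_of_mem_vbl hp.1 (mem_currentEntries.1 hpc).1).eq_of_mem_isIndepSet
              hK hsub.1 (hsub.2 hc)
            exact hb (hbc ▸ hc)
          · have := mem_usedEntries.1 h
            omega
        have hdep : DependsOn (fun Z => Z ∈ (⋂ b ∈ K', violating E L b) ∩ passing E L)
            ((K'.biUnion (currentEntries E L) ∪ usedEntries E L : Finset _) : Set (ι × ℕ)) := by
          intro Z Z' h
          refine propext (and_congr ?_ (iff_of_eq (dependsOn_passing E L fun p hp => h p ?_)))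
          · simp only [Set.mem_iInter]
            refine forall₂_congr fun c hc => iff_of_eq (dependsOn_violating E L c fun p hp => h p ?_)
            exact Finset.mem_coe.2 (Finset.mem_union_left _ (Finset.mem_biUnion.2 ⟨c, hc, hp⟩))
          · exact Finset.mem_coe.2 (Finset.mem_union_right _ hp)
        have hind := measureReal_and_of_dependsOn hXi (fun p => hX p.1 p.2)
          (measurableSet_violating hE L b)
          ((K'.measurableSet_biInter fun b _ => measurableSet_violating hE L b).inter
            (measurableSet_passing hE L)) hdisj (dependsOn_violating E L b) hdep
        rw [Finset.prod_insert hb, mul_assoc, ← ih' hsub.2,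
          ← measureReal_violating hP hPi hE hX hXi hXP L b, ← hind]
        congr 1
        ext ω
        simp only [Finset.set_biInter_insert, Set.mem_inter_iff, Set.mem_ofPred_eq, and_assoc]
    rw [List.map_cons, List.prod_cons, ← key K subset_rfl]
    congr 1
    ext ω
    simp [passing, violating, Passes]

end Witness

end ParallelLLL

namespace ParallelLLL

/-! ### Summing the weights of all witnesses. -/

section Weights

variable {ι κ : Type*} {α : ι → Type*} [Fintype κ]

theorem isIndepSet_of_mem_witnesses {E : κ → Set (∀ i, α i)} {n : ℕ} {J : Finset κ}
    {L : List (Finset κ)} (hL : L ∈ witnesses E n J) :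
    ∀ K ∈ L, (depGraph E).IsIndepSet (K : Set κ) := by
  classical
  induction n generalizing J L with
  | zero =>
    obtain rfl : L = [] := by simpa [witnesses] using hL
    simp
  | succ n ih =>
    simp only [witnesses, Finset.mem_biUnion, Finset.mem_image] at hL
    obtain ⟨K, hK, L, hL, rfl⟩ := hL
    simp only [nextLayers, Finset.mem_filter] at hK
    intro K' hK'
    rcases List.mem_cons.1 hK' with rfl | h
    · exact hK.2.2
    · exact ih hL K' h

open Classical in
/-- If `p b ≤ q * y b * ∏ 1 / (1 + y c)`, taken over the closed neighborhood of `b`, then the lists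
of `n` layers following `J` have a total weight of at most `q ^ n * ∏ (1 + y c)`, taken over the
closed neighborhoods of the elements of `J`. -/
theorem sum_witnesses_le (E : κ → Set (∀ i, α i)) {p y : κ → ℝ} {q : ℝ} (hp : ∀ b, 0 ≤ p b)
    (hy : ∀ b, 0 ≤ y b) (hq0 : 0 ≤ q) (hq1 : q ≤ 1)
    (h : ∀ b, p b * ∏ c ∈ closedNbhd E b, (1 + y c) ≤ q * y b) (n : ℕ) (J : Finset κ) :
    ∑ L ∈ witnesses E n J, (L.map fun K => ∏ b ∈ K, p b).prod ≤
      q ^ n * ∏ c ∈ J.biUnion (closedNbhd E), (1 + y c) := by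
  have hy1 : ∀ c, 1 ≤ 1 + y c := fun c => by linarith [hy c]
  have hprod : ∀ K : Finset κ, 0 ≤ ∏ c ∈ K, (1 + y c) := fun K =>
    Finset.prod_nonneg fun c _ => zero_le_one.trans (hy1 c)
  have hprodp : ∀ K : Finset κ, 0 ≤ ∏ c ∈ K, p c := fun K => Finset.prod_nonneg fun c _ => hp c
  have hprody : ∀ K : Finset κ, 0 ≤ ∏ c ∈ K, y c := fun K => Finset.prod_nonneg fun c _ => hy c
  have hunion : ∀ s t : Finset κ,
      ∏ c ∈ s ∪ t, (1 + y c) ≤ (∏ c ∈ s, (1 + y c)) * ∏ c ∈ t, (1 + y c) := fun s t => by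
    rw [← Finset.prod_union_inter]
    refine le_mul_of_one_le_right (hprod _) (Finset.one_le_prod fun c _ => hy1 c)
  -- The local condition is multiplied over `K`; overlaps of neighborhoods only help, since `1 + y c
  -- ≥ 1`.
  have hlayer : ∀ K : Finset κ, (∏ b ∈ K, p b) * ∏ c ∈ K.biUnion (closedNbhd E), (1 + y c) ≤
      q ^ K.card * ∏ b ∈ K, y b := by
    intro K
    induction K using Finset.induction_on with
    | empty => simp
    | insert b K hb ih =>
      rw [Finset.prod_insert hb, Finset.prod_insert hb, Finset.biUnion_insert,
        Finset.card_insert_of_notMem hb]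
      calc p b * (∏ b ∈ K, p b) * ∏ c ∈ closedNbhd E b ∪ K.biUnion (closedNbhd E), (1 + y c)
          ≤ p b * (∏ b ∈ K, p b) * ((∏ c ∈ closedNbhd E b, (1 + y c)) *
              ∏ c ∈ K.biUnion (closedNbhd E), (1 + y c)) :=
            mul_le_mul_of_nonneg_left (hunion _ _) (mul_nonneg (hp b) (hprodp K))
        _ = (p b * ∏ c ∈ closedNbhd E b, (1 + y c)) *
              ((∏ b ∈ K, p b) * ∏ c ∈ K.biUnion (closedNbhd E), (1 + y c)) := by ring
        _ ≤ (q * y b) * (q ^ K.card * ∏ b ∈ K, y b) :=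
            mul_le_mul (h b) ih (mul_nonneg (hprodp K) (hprod _)) (mul_nonneg hq0 (hy b))
        _ = q ^ (K.card + 1) * (y b * ∏ b ∈ K, y b) := by ring
  induction n generalizing J with
  | zero => simpa [witnesses] using Finset.one_le_prod fun c _ => hy1 c
  | succ n ih =>
    have hstep : ∀ K ∈ nextLayers E J,
        ∑ L ∈ (witnesses E n K).image (K :: ·), (L.map fun K => ∏ b ∈ K, p b).prod ≤
          q ^ (n + 1) * ∏ b ∈ K, y b := by
      intro K hK
      simp only [nextLayers, Finset.mem_filter] at hK
      rw [Finset.sum_image fun _ _ _ _ h => (List.cons.inj h).2]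
      simp only [List.map_cons, List.prod_cons]
      rw [← Finset.mul_sum]
      calc (∏ b ∈ K, p b) * ∑ L ∈ witnesses E n K, (L.map fun K => ∏ b ∈ K, p b).prod
          ≤ (∏ b ∈ K, p b) * (q ^ n * ∏ c ∈ K.biUnion (closedNbhd E), (1 + y c)) :=
            mul_le_mul_of_nonneg_left (ih K) (hprodp K)
        _ = q ^ n * ((∏ b ∈ K, p b) * ∏ c ∈ K.biUnion (closedNbhd E), (1 + y c)) := by ring
        _ ≤ q ^ n * (q ^ K.card * ∏ b ∈ K, y b) :=
            mul_le_mul_of_nonneg_left (hlayer K) (pow_nonneg hq0 n)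
        _ ≤ q ^ n * (q * ∏ b ∈ K, y b) := by
            refine mul_le_mul_of_nonneg_left (mul_le_mul_of_nonneg_right ?_ (hprody K))
              (pow_nonneg hq0 n)
            -- Nonemptiness of the layer guarantees at least one factor `q`.
            exact pow_le_of_le_one hq0 hq1 (Finset.card_ne_zero.2 hK.2.1)
        _ = q ^ (n + 1) * ∏ b ∈ K, y b := by ring
    calc ∑ L ∈ witnesses E (n + 1) J, (L.map fun K => ∏ b ∈ K, p b).prod
        ≤ ∑ K ∈ nextLayers E J, ∑ L ∈ (witnesses E n K).image (K :: ·),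
            (L.map fun K => ∏ b ∈ K, p b).prod := by
          rw [witnesses, Finset.sum_biUnion fun K _ K' _ hne => ?_]
          refine Finset.disjoint_left.2 fun L hL hL' => hne ?_
          obtain ⟨L₁, -, rfl⟩ := Finset.mem_image.1 hL
          obtain ⟨L₂, -, h₂⟩ := Finset.mem_image.1 hL'
          exact (List.cons.inj h₂).1.symm
      _ ≤ ∑ K ∈ nextLayers E J, q ^ (n + 1) * ∏ b ∈ K, y b := Finset.sum_le_sum hstep
      -- Admitting all subsets makes the sum factor as `∏ (1 + y c)`.
      _ ≤ ∑ K ∈ (J.biUnion (closedNbhd E)).powerset, q ^ (n + 1) * ∏ b ∈ K, y b :=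
          Finset.sum_le_sum_of_subset_of_nonneg (Finset.filter_subset _ _)
            fun K _ _ => mul_nonneg (pow_nonneg hq0 _) (hprody K)
      _ = q ^ (n + 1) * ∏ c ∈ J.biUnion (closedNbhd E), (1 + y c) := by
          rw [← Finset.mul_sum, Finset.prod_one_add]

/-- Since `1 + x / (1 - x) = 1 / (1 - x)`, the product over `nbhd E a` cancels, and the extra factor
for `a` itself turns `x a` into `x a / (1 - x a)`. -/
theorem mul_prod_closedNbhd_le {E : κ → Set (∀ i, α i)} {p x : κ → ℝ} {q : ℝ}
    (hx : ∀ b, x b ∈ Set.Ioo (0 : ℝ) 1) {a : κ}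
    (h : p a ≤ q * x a * ∏ b ∈ nbhd E a, (1 - x b)) :
    p a * ∏ c ∈ closedNbhd E a, (1 + x c / (1 - x c)) ≤ q * (x a / (1 - x a)) := by
  classical
  have hx0 : ∀ b, 0 < 1 - x b := fun b => by linarith [(hx b).2]
  have hinv : ∀ b, 1 + x b / (1 - x b) = (1 - x b)⁻¹ := fun b => by
    have := (hx0 b).ne'
    field_simp
    ring
  have hnbhd : closedNbhd E a = insert a (nbhd E a) := by
    ext b
    rw [closedNbhd, Finset.mem_filter]
    simp [nbhd, Related, eq_comm]
  have hnot : a ∉ nbhd E a := by simp [nbhd]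
  have hpos : 0 < ∏ b ∈ nbhd E a, (1 - x b) := Finset.prod_pos fun b _ => hx0 b
  simp only [hinv]
  rw [Finset.prod_inv_distrib, hnbhd, Finset.prod_insert hnot, ← div_eq_mul_inv,
    div_le_iff₀ (mul_pos (hx0 a) hpos)]
  have := (hx0 a).ne'
  calc p a ≤ q * x a * ∏ b ∈ nbhd E a, (1 - x b) := h
    _ = q * (x a / (1 - x a)) * ((1 - x a) * ∏ b ∈ nbhd E a, (1 - x b)) := by field_simp

end Weights

/-! ### Counting rounds, and the logarithmic series bound. -/

section Rounds

variable {ι κ : Type*} {α : ι → Type*}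

/-- By maximality, an empty selection means that nothing is violated. Each round before the first
empty selection contributes 1; if there is none, the sum is infinite. -/
theorem rounds_le_tsum {E : κ → Set (∀ i, α i)} {X : ∀ i, ℕ → α i} {S : ℕ → Set κ}
    (h : IsRun E X S) :
    (rounds E X S : ℝ≥0∞) ≤ ∑' n, {n | (S n).Nonempty}.indicator (1 : ℕ → ℝ≥0∞) n := by
  classical
  by_cases hex : ∃ n, ¬ (S n).Nonempty
  · have hfind := Nat.find_spec hex
    have hle : rounds E X S ≤ (Nat.find hex : ℕ∞) := by
      refine iInf₂_le (Nat.find hex) ?_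
      by_contra hne
      obtain ⟨a, ha⟩ := Set.nonempty_iff_ne_empty.2 hne
      obtain ⟨b, hb, -⟩ := (h (Nat.find hex)).exists_related ha
      exact hfind ⟨b, hb⟩
    calc (rounds E X S : ℝ≥0∞) ≤ ((Nat.find hex : ℕ∞) : ℝ≥0∞) := by exact_mod_cast hle
      _ = ∑ n ∈ Finset.range (Nat.find hex),
            {n | (S n).Nonempty}.indicator (1 : ℕ → ℝ≥0∞) n := by
          have hmem : ∀ n ∈ Finset.range (Nat.find hex),
              {n | (S n).Nonempty}.indicator (1 : ℕ → ℝ≥0∞) n = 1 := fun n hn =>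
            Set.indicator_of_mem (s := {n | (S n).Nonempty}) (not_not.1 (Nat.find_min hex (Finset.mem_range.1 hn))) _
          rw [Finset.sum_congr rfl hmem]
          simp
      _ ≤ _ := ENNReal.sum_le_tsum _
  · push Not at hex
    have : {n | (S n).Nonempty} = Set.univ := Set.eq_univ_of_forall hex
    simp [this]

end Rounds

/-- From `log u ≥ 1 - 1 / u` at `u = (1 + w) / (1 + q * w)`, the log difference is at least `(1 - q)
* (w / (1 + w))`. The 2 comes from `min 1 w ≤ 2 * (w / (1 + w))`, and becomes the final constant. -/
theorem mul_min_one_le_log_sub_log {q w : ℝ} (hq0 : 0 ≤ q) (hq1 : q ≤ 1) (hw : 0 ≤ w) :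
    (1 - q) * min 1 (q * w) ≤ 2 * (Real.log (1 + w) - Real.log (1 + q * w)) := by
  have hqw : 0 ≤ q * w := mul_nonneg hq0 hw
  have hle : q * w ≤ w := mul_le_of_le_one_left hw hq1
  have h1 : 1 - (1 + q * w) / (1 + w) ≤ Real.log (1 + w) - Real.log (1 + q * w) := by
    rw [← Real.log_div (by positivity) (by positivity)]
    simpa using Real.one_sub_inv_le_log_of_pos (show 0 < (1 + w) / (1 + q * w) by positivity)
  have h2 : min 1 (q * w) ≤ 2 * (w / (1 + w)) := by
    rw [← mul_div_assoc, le_div_iff₀ (by positivity)]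
    rcases le_total 1 w with hw1 | hw1
    · nlinarith [min_le_left 1 (q * w)]
    · nlinarith [min_le_right 1 (q * w)]
  have h3 : 1 - (1 + q * w) / (1 + w) = (1 - q) * (w / (1 + w)) := by
    have : 1 + w ≠ 0 := by positivity
    field_simp
    ring
  nlinarith [mul_le_mul_of_nonneg_left h2 (sub_nonneg.2 hq1)]

theorem tsum_min_one_le {ε w : ℝ} (hε0 : 0 < ε) (hε1 : ε ≤ 1) (hw : 0 ≤ w) :
    ∑' n : ℕ, ENNReal.ofReal (min 1 ((1 - ε) ^ (n + 1) * w)) ≤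
      ENNReal.ofReal (2 * (1 / ε) * Real.log (1 + w)) := by
  have hq0 : 0 ≤ 1 - ε := by linarith
  refine ENNReal.tsum_le_of_sum_range_le fun n => ?_
  rw [← ENNReal.ofReal_sum_of_nonneg fun n _ =>
    le_min zero_le_one (mul_nonneg (pow_nonneg hq0 _) hw)]
  refine ENNReal.ofReal_le_ofReal ?_
  -- The previous bound at `q = 1 - ε`, with `(1 - ε) ^ n * w` in place of `w`, makes the sum
  -- telescope.
  have hterm : ∀ n : ℕ, min 1 ((1 - ε) ^ (n + 1) * w) ≤ 2 * (1 / ε) *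
      (Real.log (1 + (1 - ε) ^ n * w) - Real.log (1 + (1 - ε) ^ (n + 1) * w)) := fun n => by
    have := mul_min_one_le_log_sub_log hq0 (by linarith) (mul_nonneg (pow_nonneg hq0 n) hw)
    rw [← mul_assoc, ← pow_succ', sub_sub_cancel] at this
    rw [mul_assoc, one_div, mul_left_comm, le_inv_mul_iff₀ hε0]
    exact this
  refine (Finset.sum_le_sum fun n _ => hterm n).trans ?_
  rw [← Finset.mul_sum, Finset.sum_range_sub' fun n => Real.log (1 + (1 - ε) ^ n * w)]
  have : 0 ≤ Real.log (1 + (1 - ε) ^ n * w) :=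
    Real.log_nonneg (by linarith [mul_nonneg (pow_nonneg hq0 n) hw])
  refine mul_le_mul_of_nonneg_left ?_ (by positivity)
  simpa using this

/-! ### Tail bounds for the rounds. -/

section Probability

variable {Ω : Type*} [MeasurableSpace Ω] {μ : Measure Ω}
  {ι : Type*} [Fintype ι] {α : ι → Type*} [∀ i, MeasurableSpace (α i)] {P : ∀ i, Ω → α i}
  {κ : Type*} [Fintype κ] {E : κ → Set (∀ i, α i)} {ε : ℝ} {x : κ → ℝ}
  {Ω' : Type*} [MeasurableSpace Ω'] {ν : Measure Ω'} [IsProbabilityMeasure ν]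
  {X : ∀ i, ℕ → Ω' → α i} {S : ℕ → Ω' → Set κ}

/-- The probability that `a` is resampled in round `n`. -/
theorem measureReal_mem_le (hP : ∀ i, Measurable (P i)) (hPi : iIndepFun P μ)
    (hE : ∀ a, MeasurableSet (E a)) (hε0 : 0 ≤ ε) (hε1 : ε ≤ 1)
    (hx : ∀ a, x a ∈ Set.Ioo (0 : ℝ) 1)
    (h : ∀ a, μ.real {ω | (fun i => P i ω) ∈ E a} ≤
      (1 - ε) * x a * ∏ b ∈ nbhd E a, (1 - x b))
    (hX : ∀ i j, Measurable (X i j)) (hXi : iIndepFun (fun p : ι × ℕ => X p.1 p.2) ν)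
    (hXP : ∀ i j, IdentDistrib (X i j) (P i) ν μ)
    (hrun : ∀ ω, IsRun E (fun i j => X i j ω) (fun n => S n ω)) (n : ℕ) (a : κ) :
    ν.real {ω | a ∈ S n ω} ≤ (1 - ε) ^ (n + 1) * (x a / (1 - x a)) := by
  classical
  set p : κ → ℝ := fun b => μ.real {ω | (fun i => P i ω) ∈ E b} with hp
  have hy : ∀ b, 0 ≤ x b / (1 - x b) := fun b =>
    div_nonneg (hx b).1.le (by linarith [(hx b).2])
  have hp0 : ∀ b, 0 ≤ p b := fun b => measureReal_nonneg
  have hloc := fun b => mul_prod_closedNbhd_le (p := p) hx (h b)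
  -- The inclusion is pointwise in `ω`, so the selection may depend on the samples in any way, even
  -- on future ones.
  have hsub : {ω | a ∈ S n ω} ⊆ ⋃ L ∈ witnesses E n {a},
      {ω | (fun p : ι × ℕ => X p.1 p.2 ω) ∈ passing E ({a} :: L)} := by
    intro ω hω
    obtain ⟨L, hL, hpass⟩ := (hrun ω).exists_witness hω
    exact Set.mem_biUnion (Finset.mem_coe.2 hL) hpass
  calc ν.real {ω | a ∈ S n ω}
      ≤ ∑ L ∈ witnesses E n {a},
          ν.real {ω | (fun p : ι × ℕ => X p.1 p.2 ω) ∈ passing E ({a} :: L)} :=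
        (measureReal_mono hsub (measure_ne_top _ _)).trans (measureReal_biUnion_finset_le _ _)
    _ = ∑ L ∈ witnesses E n {a}, p a * (L.map fun K => ∏ b ∈ K, p b).prod := by
        refine Finset.sum_congr rfl fun L hL => ?_
        rw [measureReal_passing hP hPi hE hX hXi hXP]
        · simp [hp]
        · intro K hK
          rcases List.mem_cons.1 hK with rfl | hK
          · simp
          · exact isIndepSet_of_mem_witnesses hL K hK
    _ ≤ p a * ((1 - ε) ^ n * ∏ c ∈ closedNbhd E a, (1 + x c / (1 - x c))) := by
        rw [← Finset.mul_sum]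
        refine mul_le_mul_of_nonneg_left ?_ (hp0 a)
        simpa using sum_witnesses_le E hp0 hy (by linarith) (by linarith) hloc n {a}
    _ = (1 - ε) ^ n * (p a * ∏ c ∈ closedNbhd E a, (1 + x c / (1 - x c))) := by ring
    _ ≤ (1 - ε) ^ n * ((1 - ε) * (x a / (1 - x a))) :=
        mul_le_mul_of_nonneg_left (hloc a) (pow_nonneg (by linarith) n)
    _ = (1 - ε) ^ (n + 1) * (x a / (1 - x a)) := by ring

theorem measureReal_nonempty_le (hP : ∀ i, Measurable (P i)) (hPi : iIndepFun P μ)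
    (hE : ∀ a, MeasurableSet (E a)) (hε0 : 0 ≤ ε) (hε1 : ε ≤ 1)
    (hx : ∀ a, x a ∈ Set.Ioo (0 : ℝ) 1)
    (h : ∀ a, μ.real {ω | (fun i => P i ω) ∈ E a} ≤
      (1 - ε) * x a * ∏ b ∈ nbhd E a, (1 - x b))
    (hX : ∀ i j, Measurable (X i j)) (hXi : iIndepFun (fun p : ι × ℕ => X p.1 p.2) ν)
    (hXP : ∀ i j, IdentDistrib (X i j) (P i) ν μ)
    (hrun : ∀ ω, IsRun E (fun i j => X i j ω) (fun n => S n ω)) (n : ℕ) :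
    ν.real {ω | (S n ω).Nonempty} ≤ min 1 ((1 - ε) ^ (n + 1) * ∑ a, x a / (1 - x a)) := by
  refine le_min measureReal_le_one ?_
  have hsub : {ω | (S n ω).Nonempty} ⊆ ⋃ a ∈ (Finset.univ : Finset κ), {ω | a ∈ S n ω} := by
    rintro ω ⟨a, ha⟩
    exact Set.mem_biUnion (Finset.mem_coe.2 (Finset.mem_univ a)) ha
  rw [Finset.mul_sum]
  exact (measureReal_mono hsub (measure_ne_top _ _)).trans ((measureReal_biUnion_finset_le _ _).trans
    (Finset.sum_le_sum fun a _ =>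
      measureReal_mem_le hP hPi hE hε0 hε1 hx h hX hXi hXP hrun n a))

end Probability

end ParallelLLL

theorem theorem3 :
    ∃ C : ℝ, 0 < C ∧
      -- the probability space, the independent random variables `P i`, the events `E a`
      ∀ {Ω : Type*} [MeasurableSpace Ω] (μ : Measure Ω) [IsProbabilityMeasure μ]
        {ι : Type*} [Fintype ι] {α : ι → Type*} [∀ i, MeasurableSpace (α i)]
        (P : ∀ i, Ω → α i) (_ : ∀ i, Measurable (P i)) (_ : iIndepFun P μ)
        {κ : Type*} [Fintype κ] (E : κ → Set (∀ i, α i)) (_ : ∀ a, MeasurableSet (E a))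
        -- the strengthened local lemma condition
        (ε : ℝ) (_ : 0 < ε) (x : κ → ℝ) (_ : ∀ a, x a ∈ Set.Ioo (0 : ℝ) 1)
        (_ : ∀ a, μ.real {ω | (fun i => P i ω) ∈ E a} ≤
          (1 - ε) * x a * ∏ b ∈ ParallelLLL.nbhd E a, (1 - x b))
        -- the random source: independent samples `X i 0, X i 1, …` of every variable
        {Ω' : Type*} [MeasurableSpace Ω'] (ν : Measure Ω') [IsProbabilityMeasure ν]
        (X : ∀ i, ℕ → Ω' → α i) (_ : ∀ i j, Measurable (X i j))
        (_ : iIndepFun (fun p : ι × ℕ => X p.1 p.2) ν)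
        (_ : ∀ i j, IdentDistrib (X i j) (P i) ν μ)
        -- the selected sets, chosen by any deterministic or randomized procedure
        (S : ℕ → Ω' → Set κ) (_ : ∀ n a, MeasurableSet {ω | a ∈ S n ω})
        (_ : ∀ ω, ParallelLLL.IsRun E (fun i j => X i j ω) (fun n => S n ω)),
        ∫⁻ ω, (ParallelLLL.rounds E (fun i j => X i j ω) (fun n => S n ω) : ℝ≥0∞) ∂ν ≤
          ENNReal.ofReal (C * (1 / ε) * Real.log (1 + ∑ a, x a / (1 - x a))) := by
  refine ⟨2, two_pos, ?_⟩
  intro Ω _ μ _ ι _ α _ P hP hPi κ _ E hE ε hε x hx h Ω' _ ν _ X hX hXi hXP S hS hrun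
  have hmeas : ∀ n, MeasurableSet {ω | (S n ω).Nonempty} := fun n => by
    have : {ω | (S n ω).Nonempty} = ⋃ a, {ω | a ∈ S n ω} := by
      ext ω
      simp [Set.Nonempty]
    rw [this]
    exact MeasurableSet.iUnion fun a => hS n a
  have hle : ∫⁻ ω, (ParallelLLL.rounds E (fun i j => X i j ω) (fun n => S n ω) : ℝ≥0∞) ∂ν ≤
      ∑' n, ν {ω | (S n ω).Nonempty} := by
    calc _ ≤ ∫⁻ ω, ∑' n, {ω | (S n ω).Nonempty}.indicator (1 : Ω' → ℝ≥0∞) ω ∂ν :=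
          lintegral_mono fun ω => ParallelLLL.rounds_le_tsum (hrun ω)
      _ = ∑' n, ν {ω | (S n ω).Nonempty} := by
          rw [lintegral_tsum fun n => (measurable_one.indicator (hmeas n)).aemeasurable]
          exact tsum_congr fun n => lintegral_indicator_one (hmeas n)
  refine hle.trans ?_
  rcases isEmpty_or_nonempty κ with hκ | ⟨⟨a⟩⟩
  · simp [Set.eq_empty_of_isEmpty]
  have hx0 : ∀ b, 0 < 1 - x b := fun b => by linarith [(hx b).2]
  -- As probabilities are nonnegative, a single event forces `ε ≤ 1`; this is why the empty family
  -- is treated separately.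
  have hε1 : ε ≤ 1 := by
    have hpos : 0 < x a * ∏ b ∈ ParallelLLL.nbhd E a, (1 - x b) :=
      mul_pos (hx a).1 (Finset.prod_pos fun b _ => hx0 b)
    have h0 : 0 ≤ (1 - ε) * (x a * ∏ b ∈ ParallelLLL.nbhd E a, (1 - x b)) := by
      rw [← mul_assoc]
      exact measureReal_nonneg.trans (h a)
    linarith [nonneg_of_mul_nonneg_left h0 hpos]
  refine le_trans (ENNReal.tsum_le_tsum fun n => ?_) (ParallelLLL.tsum_min_one_le hε hε1
    (Finset.sum_nonneg fun b _ => div_nonneg (hx b).1.le (hx0 b).le))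
  rw [← ofReal_measureReal]
  exact ENNReal.ofReal_le_ofReal
    (ParallelLLL.measureReal_nonempty_le hP hPi hE hε.le hε1 hx h hX hXi hXP hrun n)
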